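/- Let $d,K,S\in\mathbb N$ with $1\le S\le K$. Let $\Phi=(\phi_1,\dots,\phi_K)$ be a unit norm tight frame for $\mathbb R^d$ with frame constant $K/d$, i.e. $\|\phi_i\|_2=1$ for all $i$ and $\sum_{i=1}^K|\langle\phi_i,v\rangle|^2=\frac Kd\|v\|_2^2$ for all $v\in\mathbb R^d$; for $x\in\mathbb R^K$ write $\Phi x=\sum_i x_i\phi_i$. For $\Psi=(\psi_1,\dots,\psi_K)$ with $\psi_i\in\mathbb R^d$ and $I\subseteq\{1,\dots,K\}$ let $P_I(\Psi)$ be the orthogonal projection of $\mathbb R^d$ onto $\operatorname{span}\{\psi_i:i\in I\}$, and let $\mathcal D=\{\Psi:\|\psi_i\|_2=1\text{ for all }i\}$. Let $\nu$ be a symmetric probability measure on the unit sphere $S^{K-1}\subset\mathbb R^K$, i.e. for every measurable $\mathcal X\subseteq S^{K-1}$, every $\sigma\in\{-1,1\}^K$ and every permutation $p$ of $\{1,\dots,K\}$, the sets $\{(\sigma_1x_1,\dots,\sigma_Kx_K):x\in\mathcal X\}$ and $\{(x_{p(1)},\dots,x_{p(K)}):x\in\mathcal X\}$ have the same $\nu$-measure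 as $\mathcal X$. For $x\in\mathbb R^K$ let $c(x)=(c_1(x)\ge\dots\ge c_K(x)\ge0)$ be the non-increasing rearrangement of $|x_1|,\dots,|x_K|$; for a permutation $p$ and signs $\sigma\in\{-1,1\}^K$ let $c_{p,\sigma}(x)\in\mathbb R^K$ be the vector with entries $\sigma_i\,c_{p(i)}(x)$, and put $I_p=p^{-1}(\{1,\dots,S\})$. Suppose that there is a $\kappa>0$ such that $$\nu\Big(\Big\{x:\ \min_{p,\sigma}\Big(\|P_{I_p}(\Phi)\,\Phi c_{p,\sigma}(x)\|_2-\max_{|I|\le S,\ I\ne I_p}\|P_I(\Phi)\,\Phi c_{p,\sigma}(x)\|_2\Big)\ge 2\kappa\Big\}\Big)=1 .$$ Let $x$ be drawn from $\nu$ and let the signal be $y=\Phi x$. Then $\Phi$ is a local maximum of the expected $S$-term K-SVD criterion $$\mathcal D\ni\Psi\ \longmapsto\ \mathbb E_y\Big(\max_{|I|\le S}\|P_I(\Psi)\,y\|_2^2\Big),$$ i.e. there is an $\varepsilon>0$ such that $\mathbb E_y\big(\max_{|I|\le S}\|P_I(\Psi)y\|_2^2\big)\le\mathbb E_y\big(\max_{|I|\le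 S}\|P_I(\Phi)y\|_2^2\big)$ for all $\Psi\in\mathcal D$ with $\max_i\|\psi_i-\phi_i\|_2\le\varepsilon$. -/

import Mathlib

open MeasureTheory

noncomputable section

namespace KSVD

/-- Dictionaries of `K` unit norm atoms in `ℝ^d`, as a subset of the space of all `K`-tuples of
vectors (with its product topology, i.e. the topology of `max_i ‖ψ_i - φ_i‖`). -/
def dictionaries (d K : ℕ) : Set (Fin K → EuclideanSpace ℝ (Fin d)) :=
  {Ψ | ∀ i, ‖Ψ i‖ = 1}

/-- `Φ` is a tight frame of `ℝ^d` with frame constant `A > 0`. -/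
def IsTightFrame {d K : ℕ} (Φ : Fin K → EuclideanSpace ℝ (Fin d)) (A : ℝ) : Prop :=
  0 < A ∧ ∀ v : EuclideanSpace ℝ (Fin d), ∑ i, (inner ℝ (Φ i) v) ^ 2 = A * ‖v‖ ^ 2

/-- Synthesis: `Φ x = ∑ i, x_i φ_i`. -/
def synth {d K : ℕ} (Φ : Fin K → EuclideanSpace ℝ (Fin d)) (x : EuclideanSpace ℝ (Fin K)) :
    EuclideanSpace ℝ (Fin d) :=
  ∑ i, x i • Φ i

/-- `P_I(Ψ) y`: the orthogonal projection of `y` onto the span of the atoms indexed by `I`. -/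
def proj {d K : ℕ} (Ψ : Fin K → EuclideanSpace ℝ (Fin d)) (I : Finset (Fin K))
    (y : EuclideanSpace ℝ (Fin d)) : EuclideanSpace ℝ (Fin d) :=
  (Submodule.span ℝ (Ψ '' (I : Set (Fin K)))).starProjection y

/-- `max_{|I| ≤ S} ‖P_I(Ψ) y‖²` (a maximum over a finite nonempty family of index sets). -/
def bestProj {d K : ℕ} (S : ℕ) (Ψ : Fin K → EuclideanSpace ℝ (Fin d))
    (y : EuclideanSpace ℝ (Fin d)) : ℝ :=
  (Finset.univ.filter fun I : Finset (Fin K) => I.card ≤ S).sup' ⟨∅, by simp⟩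
    fun I => ‖proj Ψ I y‖ ^ 2

/-- The expected `S`-term K-SVD criterion `Ψ ↦ 𝔼_y max_{|I| ≤ S} ‖P_I(Ψ) y‖²`, where `y` has
law `ρ`. -/
def criterion {d K : ℕ} (S : ℕ) (ρ : Measure (EuclideanSpace ℝ (Fin d)))
    (Ψ : Fin K → EuclideanSpace ℝ (Fin d)) : ℝ :=
  ∫ y, bestProj S Ψ y ∂ρ

/-- `(σ_1 x_1, …, σ_K x_K)`; a sign is a unit of `ℤ`, i.e. `1` or `-1`. -/
def signFlip {K : ℕ} (σ : Fin K → ℤˣ) (x : EuclideanSpace ℝ (Fin K)) :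
    EuclideanSpace ℝ (Fin K) :=
  WithLp.toLp 2 fun i => ((σ i : ℤ) : ℝ) * x i

/-- `(x_{p(1)}, …, x_{p(K)})`. -/
def permute {K : ℕ} (p : Equiv.Perm (Fin K)) (x : EuclideanSpace ℝ (Fin K)) :
    EuclideanSpace ℝ (Fin K) :=
  WithLp.toLp 2 fun i => x (p i)

/-- `ν` is a symmetric probability measure on the unit sphere `S^{K-1}` of `ℝ^K` (regarded as a
Borel measure on `ℝ^K` which gives the sphere measure one). -/
structure IsSymmetricOnSphere {K : ℕ} (ν : Measure (EuclideanSpace ℝ (Fin K))) : Prop where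
  isProbabilityMeasure : IsProbabilityMeasure ν
  sphere : ν (Metric.sphere 0 1) = 1
  sign : ∀ (σ : Fin K → ℤˣ) (X : Set (EuclideanSpace ℝ (Fin K))),
    MeasurableSet X → X ⊆ Metric.sphere 0 1 → ν (signFlip σ '' X) = ν X
  perm : ∀ (p : Equiv.Perm (Fin K)) (X : Set (EuclideanSpace ℝ (Fin K))),
    MeasurableSet X → X ⊆ Metric.sphere 0 1 → ν (permute p '' X) = ν X

/-- `c(x)`: the non-increasing rearrangement of the absolute values of the entries of `x`
(`Tuple.sort f` is a permutation that makes `f` non-decreasing, so it is applied to `-|x|`). -/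
def rearr {K : ℕ} (x : EuclideanSpace ℝ (Fin K)) : EuclideanSpace ℝ (Fin K) :=
  WithLp.toLp 2 fun i => |x (Tuple.sort (fun j => -|x j|) i)|

theorem rearr_antitone {K : ℕ} (x : EuclideanSpace ℝ (Fin K)) :
    Antitone fun i => rearr x i := by
  intro i j hij
  have h := Tuple.monotone_sort (fun j => -|x j|) hij
  simpa [rearr] using h

/-- `c_{p,σ}(i) = σ_i c_{p(i)}`. -/
def signedPerm {K : ℕ} (p : Equiv.Perm (Fin K)) (σ : Fin K → ℤˣ)
    (c : EuclideanSpace ℝ (Fin K)) : EuclideanSpace ℝ (Fin K) :=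
  signFlip σ (permute p c)

/-- `I_p = p⁻¹({1, …, S})`; the indices of `Fin K` start at `0`. -/
def topSet {K : ℕ} (S : ℕ) (p : Equiv.Perm (Fin K)) : Finset (Fin K) :=
  Finset.univ.filter fun i => (p i : ℕ) < S

/-- `min_{p,σ} (‖P_{I_p}(Φ) Φ c_{p,σ}‖ - max_{|I| ≤ S, I ≠ I_p} ‖P_I(Φ) Φ c_{p,σ}‖) ≥ t`,
written out for each `p`, `σ` and `I`. -/
def HasMargin {d K : ℕ} (S : ℕ) (Φ : Fin K → EuclideanSpace ℝ (Fin d))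
    (c : EuclideanSpace ℝ (Fin K)) (t : ℝ) : Prop :=
  ∀ (p : Equiv.Perm (Fin K)) (σ : Fin K → ℤˣ) (I : Finset (Fin K)),
    I.card ≤ S → I ≠ topSet S p →
      t ≤ ‖proj Φ (topSet S p) (synth Φ (signedPerm p σ c))‖
        - ‖proj Φ I (synth Φ (signedPerm p σ c))‖

end KSVD

end

namespace KSVD

open Finset Filter Topology

/-! ### Sign averages, perturbed projections, and traces against a tight frame. -/

section Projections

variable {E : Type*} [NormedAddCommGroup E] [InnerProductSpace ℝ E]

/-! By symmetry of ν the criterion is the average of the best projection over the orbit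
`c_{p,σ}(x)`. The margin forces linear independence of every `S` atoms, so the projections vary
continuously near `Φ`, and `I_p` stays optimal for `Ψ` uniformly in `x` (`eventually_bestProj_le`).
With `I_p` fixed, averaging over signs kills cross terms and leaves `∑ j, c_j² ∑ p, ‖P_{I_p}(Ψ)
φ_{p⁻¹(j)}‖²`. Let `D_j` be the inner sum for `Φ` minus that for `Ψ`. For the `S` large coefficients
`D_j ≥ 0`, since atoms lie in their own span; for the others `D_j` is constant by exchangeability;
and `∑ D_j ≥ 0`, since a tight frame turns the total into a multiple of the rank, maximal for `Φ`.
As `c` is non-increasing, `∑ c_j² D_j ≥ 0`. -/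

theorem sum_signs_norm_sq {ι : Type*} [Fintype ι] [DecidableEq ι] (v : ι → E) :
    ∑ σ : ι → ℤˣ, ‖∑ i, ((σ i : ℤ) : ℝ) • v i‖ ^ 2
      = Fintype.card (ι → ℤˣ) * ∑ i, ‖v i‖ ^ 2 := by
  have hoff : ∀ i j, i ≠ j → ∑ σ : ι → ℤˣ, ((σ i : ℤ) : ℝ) * ((σ j : ℤ) : ℝ) = 0 := by
    intro i j hij
    -- Flipping the sign at `i` alone negates the product, so the sum equals its own negative.
    have h := Equiv.sum_comp (Equiv.mulRight (Pi.mulSingle i (-1 : ℤˣ)))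
      fun σ : ι → ℤˣ => ((σ i : ℤ) : ℝ) * ((σ j : ℤ) : ℝ)
    simp [Pi.mulSingle_eq_of_ne hij.symm, Finset.sum_neg_distrib] at h
    linarith
  have hdiag : ∀ (σ : ι → ℤˣ) i, ((σ i : ℤ) : ℝ) * ((σ i : ℤ) : ℝ) = 1 := by
    intro σ i
    rcases Int.units_eq_one_or (σ i) with h | h <;> simp [h]
  have hexp : ∀ σ : ι → ℤˣ, ‖∑ i, ((σ i : ℤ) : ℝ) • v i‖ ^ 2
      = ∑ i, ∑ j, (((σ i : ℤ) : ℝ) * ((σ j : ℤ) : ℝ)) * inner ℝ (v i) (v j) := by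
    intro σ
    rw [← real_inner_self_eq_norm_sq, sum_inner]
    refine sum_congr rfl fun i _ => ?_
    rw [inner_sum]
    refine sum_congr rfl fun j _ => ?_
    rw [real_inner_smul_left, real_inner_smul_right]; ring
  simp_rw [hexp]
  rw [sum_comm, mul_sum]
  refine sum_congr rfl fun i _ => ?_
  rw [sum_comm, sum_eq_single i]
  · simp_rw [hdiag]
    simp
  · intro j _ hj
    rw [← sum_mul, hoff i j hj.symm, zero_mul]
  · simp

theorem exists_mul_sum_abs_le_norm_of_linearIndependent {ι : Type*} [Fintype ι] {v : ι → E}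
    (hv : LinearIndependent ℝ v) :
    ∃ m : ℝ, 0 < m ∧ ∀ a : ι → ℝ, m * ∑ i, |a i| ≤ ‖∑ i, a i • v i‖ := by
  have hker : LinearMap.ker (Fintype.linearCombination ℝ v) = ⊥ :=
    LinearMap.ker_eq_bot.2 (hv.fintypeLinearCombination_injective)
  obtain ⟨C, hC, hanti⟩ := LinearMap.exists_antilipschitzWith _ hker
  -- The `+ 1` keeps the constant positive for empty `ι`.
  refine ⟨(C * (Fintype.card ι + 1))⁻¹, by positivity, fun a => ?_⟩
  have h1 : ‖a‖ ≤ C * ‖∑ i, a i • v i‖ := by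
    simpa [Fintype.linearCombination_apply] using hanti.le_mul_dist a 0
  have h2 : ∑ i, |a i| ≤ (Fintype.card ι + 1) * ‖a‖ := by
    calc ∑ i, |a i| ≤ ∑ _i : ι, ‖a‖ := sum_le_sum fun i _ => norm_le_pi_norm a i
      _ = Fintype.card ι * ‖a‖ := by simp
      _ ≤ _ := by gcongr; linarith
  rw [inv_mul_le_iff₀ (by positivity)]
  calc ∑ i, |a i| ≤ (Fintype.card ι + 1) * ‖a‖ := h2
    _ ≤ (Fintype.card ι + 1) * (C * ‖∑ i, a i • v i‖) := by gcongr
    _ = _ := by ring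

variable [FiniteDimensional ℝ E]

/-- If every vector of `V` is relatively `η`-close to `U`, then projecting onto `V` gains at most
`2 η ‖y‖` over projecting onto `U`. -/
theorem norm_starProjection_le_of_close (U V : Submodule ℝ E) {η : ℝ} (hη : 0 ≤ η)
    (h : ∀ s ∈ V, ∃ s' ∈ U, ‖s - s'‖ ≤ η * ‖s‖) (y : E) :
    ‖V.starProjection y‖ ≤ ‖U.starProjection y‖ + 2 * η * ‖y‖ := by
  set s := V.starProjection y with hs
  have hsV : s ∈ V := V.starProjection_apply_mem y
  obtain ⟨s', hs'U, hs'⟩ := h s hsV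
  have h1 : ‖s‖ ^ 2 = inner ℝ s y := by
    rw [← real_inner_self_eq_norm_sq]
    conv_lhs => rw [hs, ← V.inner_starProjection_left_eq_right, ← hs,
      Submodule.starProjection_eq_self_iff.2 hsV]
  have h2 : inner ℝ s' y = inner ℝ s' (U.starProjection y) := by
    rw [← U.inner_starProjection_left_eq_right, Submodule.starProjection_eq_self_iff.2 hs'U]
  have h3 : inner ℝ s y = inner ℝ s' (U.starProjection y) + inner ℝ (s - s') y := by
    rw [inner_sub_left, ← h2]; ring
  have h4 : ‖s'‖ ≤ (1 + η) * ‖s‖ := by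
    have : ‖s'‖ ≤ ‖s‖ + ‖s - s'‖ := by
      rw [norm_sub_rev]; exact norm_le_norm_add_norm_sub' _ _
    linarith
  have h5 := real_inner_le_norm s' (U.starProjection y)
  have h6 := real_inner_le_norm (s - s') y
  have h7 : ‖U.starProjection y‖ ≤ ‖y‖ := U.norm_starProjection_apply_le y
  have h8 : ‖s‖ * ‖s‖ ≤ ‖s‖ * (‖U.starProjection y‖ + 2 * η * ‖y‖) := by
    have a1 := mul_le_mul_of_nonneg_right h4 (norm_nonneg (U.starProjection y))
    have a2 := mul_le_mul_of_nonneg_right hs' (norm_nonneg y)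
    have a3 := mul_le_mul_of_nonneg_left h7 (mul_nonneg hη (norm_nonneg s))
    nlinarith
  rcases (norm_nonneg s).eq_or_lt with h0 | h0
  · rw [← h0]; positivity
  · exact le_of_mul_le_mul_left h8 h0

/-- Expand in an orthonormal basis of `U` and swap the sums: each basis vector contributes `A`. -/
theorem sum_norm_sq_starProjection_of_frame {ι : Type*} [Fintype ι] {φ : ι → E} {A : ℝ}
    (hφ : ∀ v : E, ∑ i, (inner ℝ (φ i) v) ^ 2 = A * ‖v‖ ^ 2) (U : Submodule ℝ E) :
    ∑ i, ‖U.starProjection (φ i)‖ ^ 2 = A * Module.finrank ℝ U := by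
  let b := stdOrthonormalBasis ℝ U
  have h : ∀ v : E, ‖U.starProjection v‖ ^ 2 = ∑ k, (inner ℝ v (b k : E)) ^ 2 := by
    intro v
    rw [Submodule.starProjection_apply, ← Submodule.coe_norm, ← b.sum_sq_norm_inner_left]
    refine sum_congr rfl fun k _ => ?_
    rw [Real.norm_eq_abs, sq_abs, U.inner_orthogonalProjectionOnto_eq_of_mem_right]
  simp_rw [h]
  rw [sum_comm]
  simp_rw [hφ]
  have : ∀ k, ‖(b k : E)‖ = 1 := fun k => b.norm_eq_one k
  simp [this, mul_comm]

end Projections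

/-- A weighted sum of differences taking one value on the large weights and one on the small. -/
theorem sum_mul_nonneg_of_two_values {ι : Type*} [Fintype ι] (T : ι → Prop) (a D : ι → ℝ)
    (t : ℝ) (ht : 0 ≤ t) (ha : ∀ j, 0 ≤ a j) (hin : ∀ j, T j → t ≤ a j)
    (hout : ∀ j, ¬ T j → a j ≤ t)
    (hDin : ∀ j, T j → 0 ≤ D j) (hDout : ∀ i j, ¬ T i → ¬ T j → D i = D j)
    (hsum : 0 ≤ ∑ j, D j) : 0 ≤ ∑ j, a j * D j := by
  by_cases h : ∀ j, 0 ≤ D j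
  · exact sum_nonneg fun j _ => mul_nonneg (ha j) (h j)
  push Not at h
  obtain ⟨i, hi⟩ := h
  have hTi : ¬ T i := fun h => (hDin i h).not_gt hi
  -- One negative value makes `D` negative everywhere off `T`, so lowering the weights on `T` and
  -- raising them off `T` to `t` can only decrease the sum.
  calc 0 ≤ t * ∑ j, D j := mul_nonneg ht hsum
    _ = ∑ j, t * D j := mul_sum _ _ _
    _ ≤ ∑ j, a j * D j := sum_le_sum fun j _ => by
      by_cases hj : T j
      · exact mul_le_mul_of_nonneg_right (hin j hj) (hDin j hj)
      · exact mul_le_mul_of_nonpos_right (hout j hj) (by rw [hDout j i hj hTi]; exact hi.le)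

/-! ### Projections onto spans of atoms, and the inequality at fixed `I_p`. -/

section Dictionary

variable {d K : ℕ}

theorem eventually_norm_proj_close {Φ : Fin K → EuclideanSpace ℝ (Fin d)} {I : Finset (Fin K)}
    (hI : LinearIndependent ℝ fun i : I => Φ i) {η : ℝ} (hη : 0 < η) :
    ∀ᶠ Ψ in 𝓝 Φ, ∀ y, ‖proj Ψ I y‖ ≤ ‖proj Φ I y‖ + 2 * η * ‖y‖ ∧
      ‖proj Φ I y‖ ≤ ‖proj Ψ I y‖ + 2 * η * ‖y‖ := by
  obtain ⟨m, hm, hΦ⟩ := exists_mul_sum_abs_le_norm_of_linearIndependent hI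
  obtain ⟨δ, hδ, hδm⟩ : ∃ δ : ℝ, 0 < δ ∧ δ ≤ η * (m - δ) :=
    -- Solves `δ = η (m - δ)`, where `m - δ` is the lower bound inherited by `Ψ`.
    ⟨η * m / (1 + η), by positivity, le_of_eq (by field_simp; ring)⟩
  filter_upwards [Metric.closedBall_mem_nhds Φ hδ] with Ψ hΨ y
  have hmem : ∀ (Θ : Fin K → EuclideanSpace ℝ (Fin d)) s,
      s ∈ Submodule.span ℝ (Θ '' (I : Set (Fin K))) ↔ ∃ a : I → ℝ, ∑ i, a i • Θ i = s := by
    intro Θ s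
    rw [Set.image_eq_range]
    exact Submodule.mem_span_range_iff_exists_fun ℝ
  have hdiff : ∀ a : I → ℝ, ‖∑ i, a i • Ψ i - ∑ i, a i • Φ i‖ ≤ δ * ∑ i, |a i| := by
    intro a
    rw [← sum_sub_distrib, mul_sum]
    refine (norm_sum_le _ _).trans (sum_le_sum fun i _ => ?_)
    rw [← smul_sub, norm_smul, Real.norm_eq_abs, mul_comm]
    refine mul_le_mul_of_nonneg_right ?_ (abs_nonneg _)
    rw [← dist_eq_norm]
    exact (dist_le_pi_dist Ψ Φ i).trans hΨ
  have hsum : ∀ a : I → ℝ, 0 ≤ ∑ i, |a i| := fun a => sum_nonneg fun i _ => abs_nonneg _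
  have hΨ' : ∀ a : I → ℝ, (m - δ) * ∑ i, |a i| ≤ ‖∑ i, a i • Ψ i‖ := by
    intro a
    have h1 := norm_le_norm_add_norm_sub (∑ i, a i • Ψ i) (∑ i, a i • Φ i)
    linarith [hdiff a, hΦ a]
  constructor
  · refine norm_starProjection_le_of_close _ _ hη.le (fun s hs => ?_) y
    obtain ⟨a, rfl⟩ := (hmem Ψ s).1 hs
    refine ⟨_, (hmem Φ _).2 ⟨a, rfl⟩, (hdiff a).trans ?_⟩
    have := mul_le_mul_of_nonneg_right hδm (hsum a)
    have := mul_le_mul_of_nonneg_left (hΨ' a) hη.le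
    linarith
  · refine norm_starProjection_le_of_close _ _ hη.le (fun s hs => ?_) y
    obtain ⟨a, rfl⟩ := (hmem Φ s).1 hs
    refine ⟨_, (hmem Ψ _).2 ⟨a, rfl⟩, ?_⟩
    rw [norm_sub_rev]
    refine (hdiff a).trans ?_
    have := mul_le_mul_of_nonneg_right hδm (hsum a)
    have := mul_le_mul_of_nonneg_left (hΦ a) hη.le
    have := mul_nonneg (mul_nonneg hη.le hδ.le) (hsum a)
    linarith

theorem card_topSet {S : ℕ} (hSK : S ≤ K) (p : Equiv.Perm (Fin K)) : (topSet S p).card = S := by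
  have h : topSet S p = (univ.filter fun j : Fin K => (j : ℕ) < S).map p.symm.toEmbedding := by
    ext i; simp [topSet]
  rw [h, card_map, Fin.card_filter_val_lt]
  simp [hSK]

theorem exists_topSet_eq {S : ℕ} (hSK : S ≤ K) {I : Finset (Fin K)} (hI : I.card = S) :
    ∃ p : Equiv.Perm (Fin K), topSet S p = I := by
  have hcard : Fintype.card {i // i ∈ I} = Fintype.card {j : Fin K // (j : ℕ) < S} := by
    rw [Fintype.card_coe, hI, Fintype.card_subtype, Fin.card_filter_val_lt]
    simp [hSK]
  let e := Fintype.equivOfCardEq hcard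
  refine ⟨e.extendSubtype, ?_⟩
  ext i
  by_cases hi : i ∈ I
  · simpa [topSet, hi] using e.extendSubtype_mem i hi
  · simpa [topSet, hi] using e.extendSubtype_not_mem i hi

/-- A redundant atom could be dropped from an `S`-set without changing its span, making the margin
zero. -/
theorem linearIndependent_of_hasMargin {S : ℕ} (hSK : S ≤ K)
    {Φ : Fin K → EuclideanSpace ℝ (Fin d)} {c : EuclideanSpace ℝ (Fin K)} {t : ℝ} (ht : 0 < t)
    (h : HasMargin S Φ c t) {I : Finset (Fin K)} (hI : I.card ≤ S) :
    LinearIndependent ℝ fun i : I => Φ i := by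
  obtain ⟨J, hIJ, hJ⟩ := Finset.exists_superset_card_eq hI (by simpa using hSK)
  suffices hJ' : LinearIndepOn ℝ Φ (J : Set (Fin K)) from
    hJ'.mono (by exact_mod_cast hIJ)
  rw [linearIndepOn_iff_notMem_span]
  intro i hi hmem
  obtain ⟨p, hp⟩ := exists_topSet_eq hSK hJ
  have hspan : Submodule.span ℝ (Φ '' ((J.erase i : Finset (Fin K)) : Set (Fin K)))
      = Submodule.span ℝ (Φ '' (J : Set (Fin K))) := by
    have : (J : Set (Fin K)) = insert i ((J : Set (Fin K)) \ {i}) := by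
      rw [Set.insert_sdiff_singleton, Set.insert_eq_of_mem hi]
    rw [coe_erase]
    conv_rhs => rw [this, Set.image_insert_eq, Submodule.span_insert_eq_span hmem]
  have h1 := h p 1 (J.erase i) ((card_erase_le).trans hJ.le)
    (by rw [hp]; exact fun h => notMem_erase i J (by rw [h]; exact hi))
  rw [hp] at h1
  simp only [proj, hspan, sub_self] at h1
  linarith

theorem sum_norm_sq_proj_le {Φ Ψ : Fin K → EuclideanSpace ℝ (Fin d)} {A : ℝ}
    (hΦ : IsTightFrame Φ A) (I : Finset (Fin K)) (hI : LinearIndependent ℝ fun i : I => Φ i) :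
    ∑ i, ‖proj Ψ I (Φ i)‖ ^ 2 ≤ ∑ i, ‖proj Φ I (Φ i)‖ ^ 2 := by
  unfold proj
  rw [sum_norm_sq_starProjection_of_frame hΦ.2, sum_norm_sq_starProjection_of_frame hΦ.2]
  refine mul_le_mul_of_nonneg_left ?_ hΦ.1.le
  have h1 : Module.finrank ℝ (Submodule.span ℝ (Φ '' (I : Set (Fin K)))) = I.card := by
    rw [Set.image_eq_range]
    exact (finrank_span_eq_card hI).trans (Fintype.card_coe I)
  rw [h1]
  have h2 := finrank_span_finset_le_card (R := ℝ) (I.image Ψ)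
  rw [Set.finrank, coe_image] at h2
  exact_mod_cast h2.trans card_image_le

/-- Swapping two values on the same side of the threshold leaves `I_p` unchanged. -/
theorem sum_perm_norm_sq_proj_eq {S : ℕ} (Ψ Φ : Fin K → EuclideanSpace ℝ (Fin d)) {j k : Fin K}
    (hjk : (j : ℕ) < S ↔ (k : ℕ) < S) :
    ∑ p : Equiv.Perm (Fin K), ‖proj Ψ (topSet S p) (Φ (p.symm j))‖ ^ 2
      = ∑ p : Equiv.Perm (Fin K), ‖proj Ψ (topSet S p) (Φ (p.symm k))‖ ^ 2 := by
  rw [← Equiv.sum_comp (Equiv.mulLeft (Equiv.swap j k))]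
  refine sum_congr rfl fun p _ => ?_
  have h1 : topSet S (Equiv.swap j k * p) = topSet S p := by
    refine filter_congr fun i _ => ?_
    rw [Equiv.Perm.mul_apply]
    rcases eq_or_ne (p i) j with h | h
    · rw [h, Equiv.swap_apply_left, hjk]
    rcases eq_or_ne (p i) k with h' | h'
    · rw [h', Equiv.swap_apply_right, hjk]
    · rw [Equiv.swap_apply_of_ne_of_ne h h']
  have h2 : (Equiv.swap j k * p).symm j = p.symm k := by
    simp [Equiv.symm_apply_eq]
  simp only [Equiv.coe_mulLeft, h1, h2]

theorem proj_synth (Ψ Φ : Fin K → EuclideanSpace ℝ (Fin d)) (I : Finset (Fin K))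
    (c : EuclideanSpace ℝ (Fin K)) : proj Ψ I (synth Φ c) = ∑ i, c i • proj Ψ I (Φ i) := by
  simp [proj, synth, map_sum]

theorem signedPerm_apply (p : Equiv.Perm (Fin K)) (σ : Fin K → ℤˣ) (c : EuclideanSpace ℝ (Fin K))
    (i : Fin K) : signedPerm p σ c i = ((σ i : ℤ) : ℝ) * c (p i) := rfl

theorem sum_signedPerm_norm_sq_proj (S : ℕ) (Ψ Φ : Fin K → EuclideanSpace ℝ (Fin d))
    (c : EuclideanSpace ℝ (Fin K)) :
    ∑ p, ∑ σ, ‖proj Ψ (topSet S p) (synth Φ (signedPerm p σ c))‖ ^ 2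
      = Fintype.card (Fin K → ℤˣ) * ∑ j, c j ^ 2 *
        ∑ p : Equiv.Perm (Fin K), ‖proj Ψ (topSet S p) (Φ (p.symm j))‖ ^ 2 := by
  simp_rw [proj_synth, signedPerm_apply, mul_smul, sum_signs_norm_sq, ← mul_sum]
  congr 1
  simp_rw [mul_sum]
  rw [sum_comm (s := univ (α := Fin K))]
  refine sum_congr rfl fun p _ => ?_
  rw [← Equiv.sum_comp p fun j => c j ^ 2 * ‖proj Ψ (topSet S p) (Φ (p.symm j))‖ ^ 2]
  refine sum_congr rfl fun i _ => ?_
  simp [norm_smul, mul_pow]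

theorem sum_signedPerm_norm_sq_proj_le {S : ℕ} (hS : 1 ≤ S) (hSK : S ≤ K)
    {Φ : Fin K → EuclideanSpace ℝ (Fin d)} {A : ℝ} (hΦ : IsTightFrame Φ A)
    (hli : ∀ I : Finset (Fin K), I.card ≤ S → LinearIndependent ℝ fun i : I => Φ i)
    (Ψ : Fin K → EuclideanSpace ℝ (Fin d)) {c : EuclideanSpace ℝ (Fin K)}
    (hc : Antitone fun i => c i) (hc0 : ∀ i, 0 ≤ c i) :
    ∑ p, ∑ σ, ‖proj Ψ (topSet S p) (synth Φ (signedPerm p σ c))‖ ^ 2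
      ≤ ∑ p, ∑ σ, ‖proj Φ (topSet S p) (synth Φ (signedPerm p σ c))‖ ^ 2 := by
  rw [sum_signedPerm_norm_sq_proj, sum_signedPerm_norm_sq_proj]
  refine mul_le_mul_of_nonneg_left ?_ (by positivity)
  rw [← sub_nonneg, ← sum_sub_distrib]
  simp_rw [← mul_sub]
  -- The zero-based index of the `S`-th largest entry, whose square separates the weights.
  let j₀ : Fin K := ⟨S - 1, by omega⟩
  refine sum_mul_nonneg_of_two_values (fun j : Fin K => (j : ℕ) < S) _ _ (c j₀ ^ 2)
    (sq_nonneg _) (fun j => sq_nonneg _) (fun j hj => ?_) (fun j hj => ?_) (fun j hj => ?_)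
    (fun i j hi hj => ?_) ?_
  · exact pow_le_pow_left₀ (hc0 _) (hc (Fin.le_def.2 (by simp only [j₀]; omega))) 2
  · exact pow_le_pow_left₀ (hc0 _) (hc (Fin.le_def.2 (by simp only [j₀]; omega))) 2
  · rw [sub_nonneg]
    refine sum_le_sum fun p _ => pow_le_pow_left₀ (norm_nonneg _) ?_ 2
    have hmem : Φ (p.symm j) ∈ Submodule.span ℝ (Φ '' (topSet S p : Set (Fin K))) :=
      Submodule.subset_span ⟨p.symm j, by simpa [topSet] using hj, rfl⟩
    have h1 : proj Φ (topSet S p) (Φ (p.symm j)) = Φ (p.symm j) :=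
      Submodule.starProjection_eq_self_iff.2 hmem
    rw [h1]
    exact Submodule.norm_starProjection_apply_le _ _
  · rw [sum_perm_norm_sq_proj_eq Φ Φ (iff_of_false hi hj),
      sum_perm_norm_sq_proj_eq Ψ Φ (iff_of_false hi hj)]
  · rw [sum_sub_distrib, sub_nonneg, sum_comm, sum_comm (s := univ (α := Fin K))]
    refine sum_le_sum fun p _ => ?_
    rw [Equiv.sum_comp p.symm fun i => ‖proj Ψ (topSet S p) (Φ i)‖ ^ 2,
      Equiv.sum_comp p.symm fun i => ‖proj Φ (topSet S p) (Φ i)‖ ^ 2]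
    exact sum_norm_sq_proj_le hΦ _ (hli _ (card_topSet hSK p).le)

theorem le_bestProj {S : ℕ} (Ψ : Fin K → EuclideanSpace ℝ (Fin d)) {I : Finset (Fin K)}
    (hI : I.card ≤ S) (y : EuclideanSpace ℝ (Fin d)) : ‖proj Ψ I y‖ ^ 2 ≤ bestProj S Ψ y :=
  le_sup' (fun I => ‖proj Ψ I y‖ ^ 2) (by simpa using hI)

theorem norm_synth_le {Φ : Fin K → EuclideanSpace ℝ (Fin d)} (hΦ : Φ ∈ dictionaries d K)
    {x : EuclideanSpace ℝ (Fin K)} (hx : ∀ i, |x i| ≤ 1) : ‖synth Φ x‖ ≤ K := by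
  calc ‖synth Φ x‖ ≤ ∑ i : Fin K, ‖x i • Φ i‖ := norm_sum_le _ _
    _ ≤ ∑ _i : Fin K, (1 : ℝ) := sum_le_sum fun i _ => by
      rw [norm_smul, hΦ i, mul_one]; exact hx i
    _ = K := by simp

theorem abs_signedPerm_apply (p : Equiv.Perm (Fin K)) (σ : Fin K → ℤˣ)
    (c : EuclideanSpace ℝ (Fin K)) (i : Fin K) : |signedPerm p σ c i| = |c (p i)| := by
  rw [signedPerm_apply, abs_mul]
  rcases Int.units_eq_one_or (σ i) with h | h <;> simp [h]

/-- Near `Φ`, the index set `I_p` stays optimal for every signal with a margin. -/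
theorem eventually_bestProj_le {S : ℕ} (hSK : S ≤ K) {Φ : Fin K → EuclideanSpace ℝ (Fin d)}
    (hunit : Φ ∈ dictionaries d K)
    (hli : ∀ I : Finset (Fin K), I.card ≤ S → LinearIndependent ℝ fun i : I => Φ i)
    {κ : ℝ} (hκ : 0 < κ) :
    ∀ᶠ Ψ in 𝓝 Φ, ∀ c : EuclideanSpace ℝ (Fin K), (∀ i, |c i| ≤ 1) → HasMargin S Φ c (2 * κ) →
      ∀ p σ, bestProj S Ψ (synth Φ (signedPerm p σ c))
        ≤ ‖proj Ψ (topSet S p) (synth Φ (signedPerm p σ c))‖ ^ 2 := by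
  -- As `‖y‖ ≤ K`, each of the two projections moves by at most `κ`, which the margin `2κ` absorbs.
  have hη : 0 < κ / (2 * (K + 1)) := by positivity
  have hev : ∀ᶠ Ψ in 𝓝 Φ, ∀ I : Finset (Fin K), I.card ≤ S → ∀ y,
      ‖proj Ψ I y‖ ≤ ‖proj Φ I y‖ + 2 * (κ / (2 * (K + 1))) * ‖y‖ ∧
      ‖proj Φ I y‖ ≤ ‖proj Ψ I y‖ + 2 * (κ / (2 * (K + 1))) * ‖y‖ := by
    rw [eventually_all]
    intro I
    rw [eventually_imp_distrib_left]
    exact fun hI => eventually_norm_proj_close (hli I hI) hη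
  filter_upwards [hev] with Ψ hΨ c hc hm p σ
  set y := synth Φ (signedPerm p σ c)
  have hy : 2 * (κ / (2 * (K + 1))) * ‖y‖ ≤ κ := by
    have h1 : ‖y‖ ≤ K := norm_synth_le hunit fun i => by
      rw [abs_signedPerm_apply]; exact hc _
    calc 2 * (κ / (2 * (K + 1))) * ‖y‖ ≤ 2 * (κ / (2 * (K + 1))) * (K + 1) := by
          gcongr; linarith
      _ = κ := by field_simp
  refine sup'_le _ _ fun I hI => pow_le_pow_left₀ (norm_nonneg _) ?_ 2
  have hI' : I.card ≤ S := by simpa using hI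
  rcases eq_or_ne I (topSet S p) with rfl | hne
  · exact le_rfl
  · have h1 := hm p σ I hI' hne
    have h2 := (hΨ I hI' y).1
    have h3 := (hΨ (topSet S p) (card_topSet hSK p).le y).2
    linarith

end Dictionary

/-! ### Signed permutations and invariance of ν. -/

section Symmetry

variable {K : ℕ}

theorem exists_rearr_eq_signedPerm (x : EuclideanSpace ℝ (Fin K)) :
    ∃ q τ, rearr x = signedPerm q τ x := by
  have h : ∀ i, ∃ u : ℤˣ, |x i| = ((u : ℤ) : ℝ) * x i := by
    intro i
    rcases abs_choice (x i) with h | h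
    · exact ⟨1, by simp [h]⟩
    · exact ⟨-1, by simp [h]⟩
  choose u hu using h
  refine ⟨Tuple.sort (fun j => -|x j|), fun i => u (Tuple.sort (fun j => -|x j|) i), ?_⟩
  ext i
  exact hu _

/-- Signed permutations form a group, so this reindexes a sum over an orbit. -/
theorem sum_signedPerm_signedPerm (F : EuclideanSpace ℝ (Fin K) → ℝ)
    (q : Equiv.Perm (Fin K)) (τ : Fin K → ℤˣ) (x : EuclideanSpace ℝ (Fin K)) :
    ∑ p, ∑ σ, F (signedPerm p σ (signedPerm q τ x)) = ∑ p, ∑ σ, F (signedPerm p σ x) := by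
  rw [← Equiv.sum_comp (Equiv.mulLeft q) fun p => ∑ σ, F (signedPerm p σ x)]
  refine sum_congr rfl fun p _ => ?_
  rw [← Equiv.sum_comp (Equiv.mulRight fun i => τ (p i))
    fun σ => F (signedPerm (Equiv.mulLeft q p) σ x)]
  refine sum_congr rfl fun σ _ => ?_
  congr 1
  ext i
  simp [signedPerm_apply, mul_assoc]

theorem continuous_signFlip (σ : Fin K → ℤˣ) : Continuous (signFlip σ) := by
  unfold signFlip; fun_prop

theorem continuous_permute (p : Equiv.Perm (Fin K)) : Continuous (permute p) := by
  unfold permute; fun_prop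

theorem signFlip_signFlip (σ : Fin K → ℤˣ) (x : EuclideanSpace ℝ (Fin K)) :
    signFlip σ (signFlip σ x) = x := by
  ext i
  rcases Int.units_eq_one_or (σ i) with h | h <;> simp [signFlip, h]

theorem permute_permute_symm (p : Equiv.Perm (Fin K)) (x : EuclideanSpace ℝ (Fin K)) :
    permute p (permute p.symm x) = x := by
  ext i; simp [permute]

variable {ν : Measure (EuclideanSpace ℝ (Fin K))}

theorem IsSymmetricOnSphere.ae_mem_sphere (hν : IsSymmetricOnSphere ν) :
    ∀ᵐ x ∂ν, x ∈ Metric.sphere (0 : EuclideanSpace ℝ (Fin K)) 1 := by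
  have := hν.isProbabilityMeasure
  exact (prob_compl_eq_zero_iff Metric.isClosed_sphere.measurableSet).2 hν.sphere

/-- A measurable bijection whose inverse preserves the measure of subsets of the sphere
preserves `ν`. -/
theorem IsSymmetricOnSphere.measurePreserving (hν : IsSymmetricOnSphere ν)
    {f g : EuclideanSpace ℝ (Fin K) → EuclideanSpace ℝ (Fin K)} (hf : Measurable f)
    (hfg : Function.RightInverse g f) (hgf : Function.LeftInverse g f)
    (h : ∀ X, MeasurableSet X → X ⊆ Metric.sphere 0 1 → ν (g '' X) = ν X) : MeasurePreserving f ν ν := by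
  have := hν.isProbabilityMeasure
  refine ⟨hf, Measure.ext fun B hB => ?_⟩
  rw [Measure.map_apply hf hB]
  have hs : MeasurableSet (Metric.sphere (0 : EuclideanSpace ℝ (Fin K)) 1) :=
    Metric.isClosed_sphere.measurableSet
  have hfull : ∀ C, ν (C ∩ Metric.sphere 0 1) = ν C := fun C =>
    measure_inter_conull ((prob_compl_eq_zero_iff hs).2 hν.sphere)
  have hpre : ∀ X, f ⁻¹' X = g '' X := fun X =>
    congrFun (Set.image_eq_preimage_of_inverse hfg hgf).symm X
  have h1 : ν (f ⁻¹' Metric.sphere 0 1) = 1 := by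
    rw [hpre, h _ hs subset_rfl, hν.sphere]
  have h2 : ν (f ⁻¹' Metric.sphere 0 1)ᶜ = 0 := (prob_compl_eq_zero_iff (hf hs)).2 h1
  rw [← hfull B, ← h _ (hB.inter hs) Set.inter_subset_right, ← hpre, Set.preimage_inter,
    measure_inter_conull h2]

theorem IsSymmetricOnSphere.measurePreserving_signedPerm (hν : IsSymmetricOnSphere ν)
    (p : Equiv.Perm (Fin K)) (σ : Fin K → ℤˣ) : MeasurePreserving (signedPerm p σ) ν ν :=
  (hν.measurePreserving (continuous_signFlip σ).measurable (signFlip_signFlip σ)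
    (signFlip_signFlip σ) (hν.sign σ)).comp
  (hν.measurePreserving (continuous_permute p).measurable (permute_permute_symm p)
    (permute_permute_symm p.symm) (hν.perm p.symm))

end Symmetry

/-! ### Integrability, and the criterion as an orbit average. -/

section Criterion

variable {d K : ℕ}

theorem continuous_bestProj (S : ℕ) (Ψ : Fin K → EuclideanSpace ℝ (Fin d)) :
    Continuous (bestProj S Ψ) := by
  unfold bestProj proj
  refine Continuous.finset_sup'_apply _ fun I _ => ?_
  fun_prop

theorem continuous_synth (Φ : Fin K → EuclideanSpace ℝ (Fin d)) : Continuous (synth Φ) := by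
  unfold synth; fun_prop

theorem bestProj_nonneg (S : ℕ) (Ψ : Fin K → EuclideanSpace ℝ (Fin d))
    (y : EuclideanSpace ℝ (Fin d)) : 0 ≤ bestProj S Ψ y :=
  (sq_nonneg _).trans (le_bestProj Ψ (I := ∅) (by simp) y)

theorem bestProj_le_norm_sq (S : ℕ) (Ψ : Fin K → EuclideanSpace ℝ (Fin d))
    (y : EuclideanSpace ℝ (Fin d)) : bestProj S Ψ y ≤ ‖y‖ ^ 2 :=
  sup'_le _ _ fun _ _ =>
    pow_le_pow_left₀ (norm_nonneg _) (Submodule.norm_starProjection_apply_le _ _) 2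

variable {ν : Measure (EuclideanSpace ℝ (Fin K))}

theorem IsSymmetricOnSphere.integrable_bestProj (hν : IsSymmetricOnSphere ν) (S : ℕ)
    {Φ : Fin K → EuclideanSpace ℝ (Fin d)} (hΦ : Φ ∈ dictionaries d K)
    (Ψ : Fin K → EuclideanSpace ℝ (Fin d)) :
    Integrable (fun x => bestProj S Ψ (synth Φ x)) ν := by
  have := hν.isProbabilityMeasure
  refine Integrable.of_bound
    ((continuous_bestProj S Ψ).comp (continuous_synth Φ)).aestronglyMeasurable ((K : ℝ) ^ 2) ?_
  filter_upwards [hν.ae_mem_sphere] with x hx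
  rw [Real.norm_of_nonneg (bestProj_nonneg _ _ _)]
  refine (bestProj_le_norm_sq _ _ _).trans (pow_le_pow_left₀ (norm_nonneg _) ?_ 2)
  refine norm_synth_le hΦ fun i => ?_
  rw [← mem_sphere_zero_iff_norm.1 hx]
  exact PiLp.norm_apply_le x i

theorem IsSymmetricOnSphere.integrable_sum_bestProj (hν : IsSymmetricOnSphere ν) (S : ℕ)
    {Φ : Fin K → EuclideanSpace ℝ (Fin d)} (hΦ : Φ ∈ dictionaries d K)
    (Ψ : Fin K → EuclideanSpace ℝ (Fin d)) :
    Integrable (fun x => ∑ p, ∑ σ, bestProj S Ψ (synth Φ (signedPerm p σ x))) ν :=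
  integrable_finsetSum _ fun p _ => integrable_finsetSum _ fun σ _ =>
    (hν.measurePreserving_signedPerm p σ).integrable_comp_of_integrable
      (hν.integrable_bestProj S hΦ Ψ)

theorem IsSymmetricOnSphere.integral_sum_bestProj (hν : IsSymmetricOnSphere ν) (S : ℕ)
    {Φ : Fin K → EuclideanSpace ℝ (Fin d)} (hΦ : Φ ∈ dictionaries d K)
    (Ψ : Fin K → EuclideanSpace ℝ (Fin d)) :
    ∫ x, ∑ p, ∑ σ, bestProj S Ψ (synth Φ (signedPerm p σ x)) ∂ν
      = Fintype.card (Equiv.Perm (Fin K)) * (Fintype.card (Fin K → ℤˣ) *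
        criterion S (ν.map (synth Φ)) Ψ) := by
  have hint : ∀ p σ, Integrable (fun x => bestProj S Ψ (synth Φ (signedPerm p σ x))) ν :=
    fun p σ => (hν.measurePreserving_signedPerm p σ).integrable_comp_of_integrable
      (hν.integrable_bestProj S hΦ Ψ)
  have hval : ∀ p σ, ∫ x, bestProj S Ψ (synth Φ (signedPerm p σ x)) ∂ν
      = criterion S (ν.map (synth Φ)) Ψ := by
    intro p σ
    have hcont : Continuous fun x => bestProj S Ψ (synth Φ x) :=
      (continuous_bestProj S Ψ).comp (continuous_synth Φ)
    have hmp := hν.measurePreserving_signedPerm p σ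
    rw [criterion, integral_map (continuous_synth Φ).aemeasurable
      (continuous_bestProj S Ψ).aestronglyMeasurable]
    conv_rhs => rw [← hmp.map_eq, integral_map hmp.aemeasurable hcont.aestronglyMeasurable]
  rw [integral_finsetSum _ fun p _ => integrable_finsetSum _ fun σ _ => hint p σ]
  simp_rw [integral_finsetSum _ fun σ _ => hint _ σ, hval]
  simp

end Criterion

end KSVD

theorem mainTheorem6 (d K S : ℕ) (hS : 1 ≤ S) (hSK : S ≤ K)
    (Φ : Fin K → EuclideanSpace ℝ (Fin d))
    (hunit : Φ ∈ KSVD.dictionaries d K)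
    (htight : KSVD.IsTightFrame Φ ((K : ℝ) / (d : ℝ)))
    (ν : Measure (EuclideanSpace ℝ (Fin K)))
    (hν : KSVD.IsSymmetricOnSphere ν)
    (κ : ℝ) (hκ : 0 < κ)
    (hmargin : ∀ᵐ x ∂ν, KSVD.HasMargin S Φ (KSVD.rearr x) (2 * κ)) :
    IsLocalMaxOn (KSVD.criterion S (ν.map (KSVD.synth Φ))) (KSVD.dictionaries d K) Φ := by
  have := hν.isProbabilityMeasure
  obtain ⟨x₀, hx₀⟩ := hmargin.exists
  have hli : ∀ I : Finset (Fin K), I.card ≤ S → LinearIndependent ℝ fun i : I => Φ i :=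
    fun I hI => KSVD.linearIndependent_of_hasMargin hSK (by positivity) hx₀ hI
  -- The bound holds for all nearby `Ψ`, unit norm or not.
  refine Filter.Eventually.filter_mono nhdsWithin_le_nhds ?_
  filter_upwards [KSVD.eventually_bestProj_le hSK hunit hli hκ] with Ψ hΨ
  have hcard : (0 : ℝ) < Fintype.card (Equiv.Perm (Fin K)) * Fintype.card (Fin K → ℤˣ) := by
    positivity
  refine le_of_mul_le_mul_left ?_ hcard
  rw [mul_assoc, mul_assoc, ← hν.integral_sum_bestProj S hunit Ψ,
    ← hν.integral_sum_bestProj S hunit Φ]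
  refine integral_mono_ae (hν.integrable_sum_bestProj S hunit Ψ)
    (hν.integrable_sum_bestProj S hunit Φ) ?_
  filter_upwards [hmargin, hν.ae_mem_sphere] with x hx hxs
  have hrearr : ∀ Θ : Fin K → EuclideanSpace ℝ (Fin d),
      ∑ p, ∑ σ, KSVD.bestProj S Θ (KSVD.synth Φ (KSVD.signedPerm p σ (KSVD.rearr x)))
        = ∑ p, ∑ σ, KSVD.bestProj S Θ (KSVD.synth Φ (KSVD.signedPerm p σ x)) := by
    intro Θ
    obtain ⟨q, τ, h⟩ := KSVD.exists_rearr_eq_signedPerm x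
    rw [h]
    exact KSVD.sum_signedPerm_signedPerm (fun z => KSVD.bestProj S Θ (KSVD.synth Φ z)) q τ x
  have hc0 : ∀ i, 0 ≤ KSVD.rearr x i := fun i => abs_nonneg _
  have hc1 : ∀ i, |KSVD.rearr x i| ≤ 1 := fun i => by
    rw [abs_of_nonneg (hc0 i), ← mem_sphere_zero_iff_norm.1 hxs]
    exact PiLp.norm_apply_le x _
  rw [← hrearr, ← hrearr]
  calc ∑ p, ∑ σ, KSVD.bestProj S Ψ (KSVD.synth Φ (KSVD.signedPerm p σ (KSVD.rearr x)))
      ≤ ∑ p, ∑ σ, ‖KSVD.proj Ψ (KSVD.topSet S p)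
          (KSVD.synth Φ (KSVD.signedPerm p σ (KSVD.rearr x)))‖ ^ 2 :=
        Finset.sum_le_sum fun p _ => Finset.sum_le_sum fun σ _ => hΨ _ hc1 hx p σ
    _ ≤ ∑ p, ∑ σ, ‖KSVD.proj Φ (KSVD.topSet S p)
          (KSVD.synth Φ (KSVD.signedPerm p σ (KSVD.rearr x)))‖ ^ 2 :=
        KSVD.sum_signedPerm_norm_sq_proj_le hS hSK htight hli Ψ (KSVD.rearr_antitone x) hc0
    _ ≤ _ := Finset.sum_le_sum fun p _ => Finset.sum_le_sum fun σ _ =>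
        KSVD.le_bestProj Φ (KSVD.card_topSet hSK p).le _
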